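/- Let $A$ be a noetherian normal integral domain. For an open subset $U\subseteq \operatorname{Spec}A$ put $F(U)=\bigcap_{\mathfrak p\in U}(A\setminus\mathfrak p)$, a saturated multiplicative system in $A$ (with $F(\emptyset)=A$), and consider on $\operatorname{Spec}A$ the presheaf of rings $U\mapsto A_{F(U)}$, where $A_{F(U)}$ is the localization of $A$ at $F(U)$ and the restriction maps $A_{F(U)}\to A_{F(V)}$ for $V\subseteq U$ are the canonical ones. Then this presheaf is equal to the structure sheaf $\mathcal O$ of $\operatorname{Spec}A$, i.e. the canonical morphism of presheaves given by $A_{F(U)}\to\Gamma(U,\mathcal O)$ is an isomorphism, if and only if $A$ is almost factorial, i.e. the divisor class group of $A$ (the free abelian group on the prime ideals of height one modulo the principal divisors $(f)=\sum_{\operatorname{ht}\mathfrak p=1}\nu_{\mathfrak p}(f)\,\mathfrak p$ of the nonzero elements $f$ of the quotient field) is a torsion group. -/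

import Mathlib

open CategoryTheory TopologicalSpace Opposite
open scoped WithZero

universe u

noncomputable section

namespace FilterPresheaf

variable (A : Type u) [CommRing A]

/-- The filter `F(U) = ⋂_{p ∈ U} (A ∖ p)` of an open subset `U` of `Spec A`: the saturated
multiplicative system of those `g` with `U ⊆ D(g)`. For `U = ∅` it is all of `A`. -/
def filter (U : Opens (PrimeSpectrum A)) : Submonoid A where
  carrier := {g | ∀ p : PrimeSpectrum A, p ∈ U → g ∉ p.asIdeal}
  one_mem' := fun p _ => p.asIdeal.primeCompl.one_mem
  mul_mem' := fun ha hb p hp => p.asIdeal.primeCompl.mul_mem (ha p hp) (hb p hp)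

variable {A} in
theorem filter_mono {U V : Opens (PrimeSpectrum A)} (h : V ≤ U) :
    filter A U ≤ filter A V :=
  fun _ hg p hp => hg p (h hp)

variable {A} in
/-- The canonical ring homomorphism `A_{F(U)} → A_{F(V)}` for `V ⊆ U`, sending `a/g` to `a/g`. -/
def restrict {U V : Opens (PrimeSpectrum A)} (h : V ≤ U) :
    Localization (filter A U) →+* Localization (filter A V) :=
  IsLocalization.map (Localization (filter A V)) (RingHom.id A)
    (show filter A U ≤ (filter A V).comap (RingHom.id A) from filter_mono h)

variable {A} in
theorem restrict_algebraMap {U V : Opens (PrimeSpectrum A)} (h : V ≤ U) (a : A) :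
    restrict h (algebraMap A (Localization (filter A U)) a) =
      algebraMap A (Localization (filter A V)) a :=
  IsLocalization.map_eq _ a

/-- The presheaf of commutative rings `U ↦ A_{F(U)}` on `Spec A`. -/
def presheaf : TopCat.Presheaf CommRingCat.{u} (AlgebraicGeometry.PrimeSpectrum.Top A) where
  obj U := CommRingCat.of (Localization (filter A U.unop))
  map i := CommRingCat.ofHom (restrict i.unop.le)
  map_id U := by
    ext : 1
    refine IsLocalization.ringHom_ext (filter A U.unop) ?_
    ext a
    simp [restrict]
  map_comp {U V W} i j := by
    ext : 1
    refine IsLocalization.ringHom_ext (filter A U.unop) ?_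
    ext a
    simp [restrict]

/-- The canonical ring homomorphism `A → Γ(U, O)`. -/
def toSections (U : Opens (PrimeSpectrum A)) :
    CommRingCat.of A ⟶ (AlgebraicGeometry.Spec.structureSheaf A).presheaf.obj (op U) :=
  CommRingCat.ofHom (algebraMap A _)

variable {A} in
theorem toSections_res {U V : Opens (PrimeSpectrum A)} (h : V ≤ U) (a : A) :
    (AlgebraicGeometry.Spec.structureSheaf A).presheaf.map (homOfLE h).op (toSections A U a) =
      toSections A V a :=
  rfl

variable {A} in
/-- An element of `F(U)` becomes a unit in the ring of sections over `U`. -/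
theorem isUnit_toSections (U : Opens (PrimeSpectrum A)) (g : filter A U) :
    IsUnit ((toSections A U).hom g) := by
  have h : U ≤ PrimeSpectrum.basicOpen (g : A) := fun p hp => g.2 p hp
  have hu : IsUnit ((toSections A (PrimeSpectrum.basicOpen (g : A))).hom g) :=
    IsLocalization.Away.algebraMap_isUnit
      (S := (AlgebraicGeometry.structureSheafInType A A).obj.obj
        (op (PrimeSpectrum.basicOpen (g : A)))) (g : A)
  exact hu.map ((AlgebraicGeometry.Spec.structureSheaf A).presheaf.map (homOfLE h).op).hom

/-- The unique homomorphism `A_{F(U)} → Γ(U, O)` compatible with the homomorphisms from `A`; it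
sends `a/g` to the section `a/g`. -/
def toSectionsLift (U : Opens (PrimeSpectrum A)) :
    CommRingCat.of (Localization (filter A U)) ⟶
      (AlgebraicGeometry.Spec.structureSheaf A).presheaf.obj (op U) :=
  CommRingCat.ofHom (IsLocalization.lift (M := filter A U) (g := (toSections A U).hom)
    (isUnit_toSections U))

/-- The canonical morphism of presheaves of rings from `U ↦ A_{F(U)}` to the structure sheaf. -/
def toStructureSheaf :
    presheaf A ⟶ (AlgebraicGeometry.Spec.structureSheaf A).presheaf where
  app U := toSectionsLift A U.unop
  naturality {U V} i := by
    apply CommRingCat.hom_ext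
    refine IsLocalization.ringHom_ext (R := A) (S := Localization (filter A U.unop))
      (filter A U.unop) ?_
    refine RingHom.ext fun a => ?_
    have h1 : (toSectionsLift A V.unop).hom (restrict i.unop.le
        (algebraMap A (Localization (filter A U.unop)) a)) = (toSections A V.unop).hom a := by
      refine (congrArg (toSectionsLift A V.unop).hom (restrict_algebraMap i.unop.le a)).trans ?_
      exact IsLocalization.lift_eq _ _
    have h2 : (toSectionsLift A U.unop).hom
        (algebraMap A (Localization (filter A U.unop)) a) = (toSections A U.unop).hom a :=
      IsLocalization.lift_eq _ _
    refine h1.trans (Eq.trans ?_ (congrArg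
      ((AlgebraicGeometry.Spec.structureSheaf A).presheaf.map i).hom h2).symm)
    exact (toSections_res i.unop.le a).symm

end FilterPresheaf

namespace WeilDivisor

variable (A : Type u) [CommRing A]

/-- The prime ideals of height one of `A`. -/
def HeightOnePrime : Type u := {p : PrimeSpectrum A // p.asIdeal.height = 1}

variable {A} in
/-- The localization `A_p`. -/
abbrev HeightOnePrime.localRing (p : HeightOnePrime A) : Type u :=
  Localization.AtPrime p.1.asIdeal

variable [IsDomain A] [IsNoetherianRing A]

variable {A} in
/-- In a noetherian domain only finitely many primes of height one contain a given nonzero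
element. -/
theorem finite_setOf_mem {x : A} (hx : x ≠ 0) :
    {p : HeightOnePrime A | x ∈ p.1.asIdeal}.Finite := by
  refine Set.Finite.of_finite_image
    (f := fun p : HeightOnePrime A => p.1.asIdeal) ?_ ?_
  · refine (Ideal.finite_minimalPrimes_of_isNoetherianRing A (Ideal.span {x})).subset ?_
    rintro _ ⟨p, hp, rfl⟩
    refine Ideal.mem_minimalPrimes_of_height_le
      ((Ideal.span_singleton_le_iff_mem _).2 hp) ?_
    rw [p.2]
    exact Ideal.one_le_height_span_singleton_of_mem_nonZeroDivisors
      (mem_nonZeroDivisors_of_ne_zero hx)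
  · intro p _ q _ h
    exact Subtype.ext (PrimeSpectrum.ext h)

variable [IsIntegrallyClosed A]

/-- The local ring of a normal noetherian domain at a prime of height one is a discrete valuation
ring. -/
instance isDiscreteValuationRing (p : HeightOnePrime A) :
    IsDiscreteValuationRing p.localRing := by
  have hdim : ringKrullDim p.localRing = 1 := by
    rw [IsLocalization.AtPrime.ringKrullDim_eq_height p.1.asIdeal p.localRing, p.2]
    rfl
  have hnf : ¬ IsField p.localRing := by
    intro h
    rw [ringKrullDim_eq_zero_of_isField h] at hdim
    exact zero_ne_one hdim
  have h1 : Ring.KrullDimLE 1 p.localRing := Ring.krullDimLE_iff.mpr hdim.le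
  have hic : IsIntegrallyClosed p.localRing :=
    isIntegrallyClosed_of_isLocalization _ p.1.asIdeal.primeCompl
      p.1.asIdeal.primeCompl_le_nonZeroDivisors
  refine ((IsDiscreteValuationRing.TFAE p.localRing hnf).out 0 3
    (a := IsDiscreteValuationRing p.localRing)
    (b := IsIntegrallyClosed p.localRing ∧ ∃! P : Ideal p.localRing, P ≠ ⊥ ∧ P.IsPrime)).2
    ⟨hic, ?_⟩
  refine ⟨IsLocalRing.maximalIdeal _,
    ⟨fun h => hnf (IsLocalRing.isField_iff_maximalIdeal_eq.2 h), inferInstance⟩, ?_⟩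
  rintro P ⟨hP0, hP⟩
  exact IsLocalRing.eq_maximalIdeal (hP.isMaximal_of_ne_bot hP0)

variable {A} in
/-- The additive valuation `ν_p : Q(A)ˣ → ℤ` of a prime `p` of height one: the normalized valuation
of the discrete valuation ring `A_p`, whose fraction field is `Q(A)`. Mathlib's adic valuation is
multiplicative and takes the value `exp (-n)` where the order is `n`, hence the sign. -/
def ord (p : HeightOnePrime A) (f : (FractionRing A)ˣ) : ℤ :=
  -WithZero.log
    ((IsDiscreteValuationRing.maximalIdeal p.localRing).valuation (FractionRing A)
      (f : FractionRing A))

variable {A} in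
theorem ord_mul (p : HeightOnePrime A) (f g : (FractionRing A)ˣ) :
    ord p (f * g) = ord p f + ord p g := by
  rw [ord, ord, ord, Units.val_mul, map_mul, WithZero.log_mul, neg_add]
  · exact (Valuation.ne_zero_iff _).2 f.ne_zero
  · exact (Valuation.ne_zero_iff _).2 g.ne_zero

variable {A} in
theorem valuation_eq_one (p : HeightOnePrime A) {a : A} (ha : a ∉ p.1.asIdeal) :
    (IsDiscreteValuationRing.maximalIdeal p.localRing).valuation (FractionRing A)
      (algebraMap A (FractionRing A) a) = 1 := by
  rw [IsScalarTower.algebraMap_apply A p.localRing (FractionRing A),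
    IsDedekindDomain.HeightOneSpectrum.valuation_eq_one_iff_notMem]
  intro h
  exact ha ((IsLocalization.AtPrime.to_map_mem_maximal_iff p.localRing p.1.asIdeal a).1 h)

variable {A} in
/-- A nonzero rational function has nonzero order at only finitely many primes of height one. -/
theorem finite_ord_ne_zero (f : (FractionRing A)ˣ) :
    {p : HeightOnePrime A | ord p f ≠ 0}.Finite := by
  obtain ⟨a, b, hb, hf⟩ := IsFractionRing.div_surjective (A := A) (f : FractionRing A)
  have hb0 : b ≠ 0 := nonZeroDivisors.ne_zero hb
  have ha0 : a ≠ 0 := by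
    rintro rfl
    rw [map_zero, zero_div] at hf
    exact f.ne_zero hf.symm
  refine ((finite_setOf_mem ha0).union (finite_setOf_mem hb0)).subset ?_
  intro p hp
  by_contra h
  simp only [Set.mem_union, Set.mem_ofPred_eq, not_or] at h
  apply hp
  rw [ord, ← hf, map_div₀, valuation_eq_one p h.1, valuation_eq_one p h.2, div_one,
    WithZero.log_one, neg_zero]

/-- The group of (Weil) divisors: the free abelian group on the primes of height one. -/
abbrev Divisor : Type u := HeightOnePrime A →₀ ℤ

/-- The homomorphism sending `f` to its principal divisor `(f) = ∑_p ν_p(f) p`. -/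
def principal : Additive (FractionRing A)ˣ →+ Divisor A :=
  AddMonoidHom.mk'
    (fun f => Finsupp.ofSupportFinite (fun p => ord p f.toMul) (finite_ord_ne_zero f.toMul))
    (fun f g => Finsupp.ext fun p => ord_mul p f.toMul g.toMul)

/-- The divisor class group: divisors modulo principal divisors. -/
abbrev DivisorClassGroup : Type u := Divisor A ⧸ (principal A).range

/-- A noetherian normal domain is almost factorial if its divisor class group is torsion. -/
def IsAlmostFactorial : Prop := IsAddTorsion (DivisorClassGroup A)

end WeilDivisor

end

/-!
The proof compares, for each open `U`, two sets of rational functions `f` in the quotient field: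
those lying in `A_q` for all `q ∈ U` (`IsDefinedAt`), which are the sections of the structure sheaf
over `U`, and those of the form `a/g` with `g ∈ F(U)`. The canonical morphism is an isomorphism if
and only if the two sets agree for all `U` (`isIso_toStructureSheaf_iff`). Over `U = ∅` both rings
are zero.

If the class group is torsion and `f` is defined on `U`, then a positive multiple of the divisor of
poles of `f` is principal, say the divisor of `g`. Since `A` is the intersection of its
localizations at primes of height one (`mem_range_of_isDefinedAt`), both `g` and `f g` lie in `A`.
By Krull's principal ideal theorem, a zero of `g` contains a prime of height one at which `f` has a
pole, so it is not in `U`; thus `g ∈ F(U)` (`IsAlmostFactorial.exists_mem_filter`).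

Conversely, let `p` be a prime of height one. There is a rational function `f` whose ideal of
denominators `{x | f x ∈ A}` is exactly `p` (`exists_mem_iff_mul_mem_range`). It is defined on the
complement of `V(p)`, so by assumption it has a denominator `h` without zeros there. Being a
denominator, `h` lies in `p`, so its divisor is a positive multiple of `p`
(`isOfFinAddOrder_single`). The classes of such `p` generate the class group.
-/

namespace FilterPresheaf

variable {A : Type u} [CommRing A]

/-- The fraction `f` has a denominator outside `q`. For a domain `A` this says that the element `f` of
the quotient field lies in the local ring `A_q`, without reference to an embedding of `A_q`. -/
def IsDefinedAt (f : FractionRing A) (q : PrimeSpectrum A) : Prop :=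
  ∃ a b : A, b ∉ q.asIdeal ∧ f * algebraMap A (FractionRing A) b = algebraMap A (FractionRing A) a

theorem IsDefinedAt.of_le {f : FractionRing A} {p q : PrimeSpectrum A}
    (h : IsDefinedAt f q) (hpq : p.asIdeal ≤ q.asIdeal) : IsDefinedAt f p := by
  obtain ⟨a, b, hb, hab⟩ := h
  exact ⟨a, b, fun hbp => hb (hpq hbp), hab⟩

/-! ### Sections of the structure sheaf as elements of the quotient field -/

section Sections

open AlgebraicGeometry StructureSheaf

theorem mul_eq_mul_of_mul_algebraMap_eq {f : FractionRing A} {a b c d : A}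
    (hab : f * algebraMap A (FractionRing A) b = algebraMap A (FractionRing A) a)
    (hcd : f * algebraMap A (FractionRing A) d = algebraMap A (FractionRing A) c) :
    a * d = c * b := by
  refine IsFractionRing.injective A (FractionRing A) ?_
  rw [map_mul, map_mul, ← hab, ← hcd, mul_right_comm]

theorem toSectionsLift_mk' {U : Opens (PrimeSpectrum A)} (a : A) (g : filter A U) :
    (toSectionsLift A U).hom (IsLocalization.mk' (Localization (filter A U)) a g) =
      const a (g : A) U (fun p hp => g.2 p hp) := by
  refine (IsLocalization.lift_mk'_spec (M := filter A U) (g := (toSections A U).hom) _ _ _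
    (hg := isUnit_toSections U)).2 ?_
  have h : ∀ x : A, (toSections A U).hom x = const x 1 U (fun p _ => p.2.one_notMem) :=
    fun x => rfl
  rw [h, h]
  refine Eq.trans ?_ (const_mul (g : A) a 1 (g : A) U _ _).symm
  exact const_ext (by simp)

variable [IsDomain A]

theorem mk_eq_mk_iff {q : PrimeSpectrum A} {a a' : A} {b b' : q.asIdeal.primeCompl} :
    (LocalizedModule.mk a b : LocalizedModule q.asIdeal.primeCompl A) = LocalizedModule.mk a' b' ↔
      a * b' = a' * b := by
  rw [LocalizedModule.mk_eq]
  constructor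
  · rintro ⟨c, hc⟩
    have hc0 : (c : A) ≠ 0 := fun h => c.2 (h ▸ q.asIdeal.zero_mem)
    simp only [Submonoid.smul_def, smul_eq_mul] at hc
    have := mul_left_cancel₀ hc0 hc
    linear_combination this
  · intro h
    refine ⟨1, ?_⟩
    simp only [Submonoid.smul_def, smul_eq_mul, one_smul]
    linear_combination h

/-- On a nonempty open set every section is given by a single element of the quotient field,
namely its value at the generic point. -/
theorem exists_eq_of_section {U : Opens (PrimeSpectrum A)} {q₀ : PrimeSpectrum A} (hq₀ : q₀ ∈ U)
    (s : (structureSheafInType A A).obj.obj (op U)) :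
    ∃ f : FractionRing A, ∀ q : U, ∃ (a b : A) (hb : b ∉ q.1.asIdeal),
      f * algebraMap A (FractionRing A) b = algebraMap A (FractionRing A) a ∧
        s.1 q = LocalizedModule.mk a ⟨b, hb⟩ := by
  let η : PrimeSpectrum A := ⊥
  have generic_mem : ∀ {V : Opens (PrimeSpectrum A)} {q : PrimeSpectrum A}, q ∈ V → η ∈ V :=
    fun {V q} hq => ((PrimeSpectrum.le_iff_specializes η q).1 bot_le).mem_open V.2 hq
  obtain ⟨V₀, hV₀, i₀, a₀, b₀, h₀⟩ := s.2 ⟨η, generic_mem hq₀⟩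
  obtain ⟨hb₀, hs₀⟩ := h₀ ⟨η, hV₀⟩
  have hb₀' : algebraMap A (FractionRing A) b₀ ≠ 0 := by
    rw [Ne, IsFractionRing.to_map_eq_zero_iff]
    exact fun h => hb₀ (h ▸ Ideal.zero_mem _)
  refine ⟨algebraMap A (FractionRing A) a₀ / algebraMap A (FractionRing A) b₀, fun q => ?_⟩
  obtain ⟨V, hV, i, a, b, h⟩ := s.2 q
  obtain ⟨hb, hs⟩ := h ⟨q.1, hV⟩
  obtain ⟨hb', hs'⟩ := h ⟨η, generic_mem hV⟩
  refine ⟨a, b, hb, ?_, hs⟩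
  have key : a₀ * b = a * b₀ := mk_eq_mk_iff.1 (hs₀.symm.trans hs')
  rw [div_mul_eq_mul_div, div_eq_iff hb₀', ← map_mul, ← map_mul, key]

/-- An element of the quotient field lying in all the local rings at points of `U` defines a
section over `U`. -/
theorem exists_section_of_isDefinedAt {U : Opens (PrimeSpectrum A)} {f : FractionRing A}
    (hf : ∀ q ∈ U, IsDefinedAt f q) :
    ∃ s : (structureSheafInType A A).obj.obj (op U), ∀ q : U, ∃ (a b : A) (hb : b ∉ q.1.asIdeal),
      f * algebraMap A (FractionRing A) b = algebraMap A (FractionRing A) a ∧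
        s.1 q = LocalizedModule.mk a ⟨b, hb⟩ := by
  choose a b hb hab using fun q : U => hf q.1 q.2
  refine ⟨⟨fun q => LocalizedModule.mk (a q) ⟨b q, hb q⟩, fun q => ?_⟩,
    fun q => ⟨a q, b q, hb q, hab q, rfl⟩⟩
  refine ⟨U ⊓ PrimeSpectrum.basicOpen (b q), ⟨q.2, hb q⟩, Opens.infLELeft _ _, a q, b q,
    fun x => ⟨x.2.2, ?_⟩⟩
  exact mk_eq_mk_iff.2 (mul_eq_mul_of_mul_algebraMap_eq (hab ⟨x.1, x.2.1⟩) (hab q))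

/-- The canonical map `A_{F(U)} → Γ(U, O)` is always injective, and it is surjective if and only if
every rational function defined on `U` has a denominator in `F(U)`. -/
theorem bijective_toSectionsLift_iff (U : Opens (PrimeSpectrum A)) :
    Function.Bijective (toSectionsLift A U).hom ↔
      ∀ f : FractionRing A, (∀ q ∈ U, IsDefinedAt f q) → ∃ a : A, ∃ g ∈ filter A U,
        f * algebraMap A (FractionRing A) g = algebraMap A (FractionRing A) a := by
  constructor
  · rintro ⟨-, hsurj⟩ f hf
    by_cases hne : ∃ q, q ∈ U
    · obtain ⟨q, hq⟩ := hne
      obtain ⟨s, hs⟩ := exists_section_of_isDefinedAt hf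
      obtain ⟨x, hx⟩ := hsurj s
      obtain ⟨a, g, rfl⟩ := IsLocalization.exists_mk'_eq (filter A U) x
      rw [toSectionsLift_mk'] at hx
      obtain ⟨c, d, hd, hcd, hsq⟩ := hs ⟨q, hq⟩
      have key : a * d = c * g :=
        mk_eq_mk_iff.1 ((congrFun (congrArg Subtype.val hx) ⟨q, hq⟩).trans hsq)
      have hd0 : algebraMap A (FractionRing A) d ≠ 0 := by
        rw [Ne, IsFractionRing.to_map_eq_zero_iff]
        exact fun h => hd (h ▸ q.asIdeal.zero_mem)
      refine ⟨a, g, g.2, mul_right_cancel₀ hd0 ?_⟩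
      rw [← map_mul, key, map_mul, ← hcd, mul_right_comm]
    · -- Over the empty set `0` is a denominator.
      exact ⟨0, 0, fun q hq => absurd ⟨q, hq⟩ hne, by simp⟩
  · intro hU
    refine ⟨fun x y hxy => ?_, fun s => ?_⟩
    · obtain ⟨a, g, rfl⟩ := IsLocalization.exists_mk'_eq (filter A U) x
      obtain ⟨a', g', rfl⟩ := IsLocalization.exists_mk'_eq (filter A U) y
      rw [toSectionsLift_mk', toSectionsLift_mk'] at hxy
      rw [IsLocalization.eq]
      by_cases hne : ∃ q, q ∈ U
      · obtain ⟨q, hq⟩ := hne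
        have h : a * g' = a' * g := mk_eq_mk_iff.1 (congrFun (congrArg Subtype.val hxy) ⟨q, hq⟩)
        exact ⟨1, congrArg _ (by linear_combination h)⟩
      · -- Over the empty set `0` is a denominator.
        exact ⟨⟨0, fun q hq => absurd ⟨q, hq⟩ hne⟩, by simp⟩
    · by_cases hne : ∃ q, q ∈ U
      · obtain ⟨q₀, hq₀⟩ := hne
        obtain ⟨f, hf⟩ := exists_eq_of_section hq₀ s
        obtain ⟨a, g, hg, hfg⟩ := hU f fun q hq => by
          obtain ⟨a, b, hb, hab, -⟩ := hf ⟨q, hq⟩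
          exact ⟨a, b, hb, hab⟩
        refine ⟨IsLocalization.mk' _ a ⟨g, hg⟩, ?_⟩
        rw [toSectionsLift_mk']
        refine Subtype.ext (funext fun q => ?_)
        obtain ⟨c, d, hd, hcd, hs⟩ := hf q
        exact Eq.trans (mk_eq_mk_iff.2 (mul_eq_mul_of_mul_algebraMap_eq hfg hcd)) hs.symm
      · exact ⟨0, Subtype.ext (funext fun q => absurd ⟨q.1, q.2⟩ hne)⟩

theorem isIso_toStructureSheaf_iff :
    IsIso (toStructureSheaf A) ↔ ∀ (U : Opens (PrimeSpectrum A)) (f : FractionRing A),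
      (∀ q ∈ U, IsDefinedAt f q) → ∃ a : A, ∃ g ∈ filter A U,
        f * algebraMap A (FractionRing A) g = algebraMap A (FractionRing A) a := by
  simp_rw [← bijective_toSectionsLift_iff]
  rw [NatTrans.isIso_iff_isIso_app]
  constructor
  · intro h U
    exact (ConcreteCategory.isIso_iff_bijective _).1 (h (op U))
  · intro h U
    exact (ConcreteCategory.isIso_iff_bijective (toSectionsLift A U.unop)).2 (h U.unop)

end Sections

end FilterPresheaf

namespace WeilDivisor

open FilterPresheaf

/-! ### Primes of height one as annihilators of rational functions modulo `A` -/

variable {A : Type u} [CommRing A]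

theorem HeightOnePrime.finiteHeight (p : HeightOnePrime A) : p.1.asIdeal.FiniteHeight :=
  ⟨Or.inr (by rw [p.2]; exact ENat.one_ne_top)⟩

variable [IsDomain A]

theorem HeightOnePrime.asIdeal_ne_bot (p : HeightOnePrime A) : p.1.asIdeal ≠ ⊥ := by
  intro h
  have := p.2
  rw [h, Ideal.height_bot] at this
  exact zero_ne_one this

variable [IsNoetherianRing A]

/-- A minimal prime over a nonzero principal ideal has height one (Krull). -/
theorem exists_heightOnePrime_le {h : A} (h0 : h ≠ 0) {q : PrimeSpectrum A} (hq : h ∈ q.asIdeal) :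
    ∃ p : HeightOnePrime A, h ∈ p.1.asIdeal ∧ p.1.asIdeal ≤ q.asIdeal := by
  obtain ⟨P, hP, hPq⟩ := Ideal.exists_minimalPrimes_le
    ((Ideal.span_singleton_le_iff_mem q.asIdeal).2 hq)
  have hPp : P.IsPrime := hP.1.1
  have hhP : h ∈ P := (Ideal.span_singleton_le_iff_mem P).1 hP.1.2
  refine ⟨⟨⟨P, hPp⟩, le_antisymm ?_ ?_⟩, hhP, hPq⟩
  · exact Ideal.height_le_one_of_isPrincipal_of_mem_minimalPrimes (Ideal.span {h}) P hP
  · exact Ideal.one_le_height_span_singleton_of_mem_nonZeroDivisors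
      (mem_nonZeroDivisors_of_ne_zero h0) |>.trans (Ideal.height_mono hP.1.2)

/-- A prime `p` of height one is associated to `Q(A)/A`: it consists of the denominators of some
rational function `f`. If `p` is minimal over `(a)`, then `p = ((a) : c)` and `f = c/a`. -/
theorem exists_mem_iff_mul_mem_range (p : HeightOnePrime A) :
    ∃ f : FractionRing A, ∀ x : A, x ∈ p.1.asIdeal ↔
      f * algebraMap A (FractionRing A) x ∈ (algebraMap A (FractionRing A)).range := by
  obtain ⟨a, ha, ha0⟩ := Submodule.exists_mem_ne_zero_of_ne_bot p.asIdeal_ne_bot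
  have hmin : p.1.asIdeal ∈ (Ideal.span {a}).minimalPrimes := by
    have := p.finiteHeight
    refine Ideal.mem_minimalPrimes_of_height_le ((Ideal.span_singleton_le_iff_mem _).2 ha) ?_
    rw [p.2]
    exact Ideal.one_le_height_span_singleton_of_mem_nonZeroDivisors
      (mem_nonZeroDivisors_of_ne_zero ha0)
  have hcolon : Submodule.colon (Ideal.span {a}) {(1 : A)} = Ideal.span {a} := by
    ext x
    simp [Submodule.mem_colon_singleton]
  obtain ⟨c, hc⟩ := Submodule.exists_eq_colon_of_mem_minimalPrimes
    (N := Ideal.span {a}) (x := (1 : A)) (I := p.1.asIdeal) (by rwa [hcolon])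
  have ha' : algebraMap A (FractionRing A) a ≠ 0 := by
    rwa [Ne, IsFractionRing.to_map_eq_zero_iff]
  refine ⟨algebraMap A (FractionRing A) c / algebraMap A (FractionRing A) a, fun x => ?_⟩
  rw [hc, Submodule.mem_colon_singleton, smul_eq_mul, Ideal.mem_span_singleton']
  refine exists_congr fun y => ?_
  rw [div_mul_eq_mul_div, eq_div_iff ha', ← map_mul, ← map_mul,
    (IsFractionRing.injective A (FractionRing A)).eq_iff, mul_comm c]

variable [IsIntegrallyClosed A]

/-- In a noetherian normal domain the prime ideals associated to `Q(A)/A` have height one. Let `P`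
be the ideal of denominators of `g`. If `g P ⊆ P`, then `g` would be integral over `A`; hence there
is `x ∈ P` with `g x ∉ P`, and then `P` is minimal over `(x)`. -/
theorem height_eq_one_of_forall_mem_iff {P : Ideal A} [hP : P.IsPrime] {g : FractionRing A}
    (hg : ∀ x : A, x ∈ P ↔
      g * algebraMap A (FractionRing A) x ∈ (algebraMap A (FractionRing A)).range) :
    P.height = 1 := by
  have hinj := IsFractionRing.injective A (FractionRing A)
  obtain ⟨a, b, hb, hab⟩ := IsFractionRing.div_surjective (A := A) g
  have hb0 : b ≠ 0 := nonZeroDivisors.ne_zero hb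
  have hbK : algebraMap A (FractionRing A) b ≠ 0 := by
    rwa [Ne, IsFractionRing.to_map_eq_zero_iff]
  have hbP : b ∈ P := (hg b).2 ⟨a, by rw [← hab, div_mul_cancel₀ _ hbK]⟩
  obtain ⟨x, hx, u, hu, hgx⟩ : ∃ x ∈ P, ∃ u ∉ P,
      algebraMap A (FractionRing A) u = g * algebraMap A (FractionRing A) x := by
    by_contra! hcon
    have hint : IsIntegral A g := by
      refine isIntegral_of_smul_mem_submodule
        (Submodule.map (Algebra.linearMap A (FractionRing A)) P) ?_
        ((IsNoetherian.noetherian P).map _) g ?_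
      · rw [Submodule.ne_bot_iff]
        exact ⟨_, Submodule.mem_map_of_mem hbP, hbK⟩
      · rintro _ ⟨x, hx, rfl⟩
        obtain ⟨u, hu⟩ := (hg x).1 hx
        exact ⟨u, by_contra fun huP => hcon x hx u huP hu, hu⟩
    obtain ⟨y, rfl⟩ := IsIntegrallyClosed.isIntegral_iff.1 hint
    exact hP.one_notMem ((hg 1).2 ⟨y, by rw [map_one, mul_one]⟩)
  refine le_antisymm (Ideal.height_le_one_of_isPrincipal_of_mem_minimalPrimes (Ideal.span {x}) P
    ⟨⟨hP, (Ideal.span_singleton_le_iff_mem _).2 hx⟩, ?_⟩) ?_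
  · rintro Q ⟨hQ, hxQ⟩ hQP y hy
    obtain ⟨v, hv⟩ := (hg y).1 hy
    have huy : u * y = v * x := hinj (by rw [map_mul, map_mul, hgx, hv]; ring)
    refine (hQ.mem_or_mem (x := u) (y := y) ?_).resolve_left fun h => hu (hQP h)
    rw [huy]
    exact Ideal.mul_mem_left _ _ ((Ideal.span_singleton_le_iff_mem _).1 hxQ)
  · exact (Ideal.one_le_height_span_singleton_of_mem_nonZeroDivisors
      (mem_nonZeroDivisors_of_ne_zero hb0)).trans
      (Ideal.height_mono ((Ideal.span_singleton_le_iff_mem P).2 hbP))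

/-- A noetherian normal domain is the intersection of its localizations at primes of height one. -/
theorem mem_range_of_isDefinedAt {f : FractionRing A}
    (hf : ∀ p : HeightOnePrime A, IsDefinedAt f p.1) :
    f ∈ (algebraMap A (FractionRing A)).range := by
  -- Otherwise the denominators of `f` lie in a prime associated to `Q(A)/A`.
  by_contra hfA
  let N : Submodule A (FractionRing A) := LinearMap.range (Algebra.linearMap A (FractionRing A))
  obtain ⟨P, hP, hfP⟩ := exists_le_isAssociatedPrime_of_isNoetherianRing A
    (Submodule.Quotient.mk (p := N) f) (by rwa [Ne, Submodule.Quotient.mk_eq_zero])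
  rw [isAssociatedPrime_iff] at hP
  obtain ⟨hPp, g, hPg⟩ := hP
  obtain ⟨g, rfl⟩ := Submodule.Quotient.mk_surjective N g
  have mem_colon : ∀ (g : FractionRing A) (x : A),
      x ∈ (⊥ : Submodule A (FractionRing A ⧸ N)).colon {Submodule.Quotient.mk g} ↔
        g * algebraMap A (FractionRing A) x ∈ (algebraMap A (FractionRing A)).range := by
    intro g x
    rw [Submodule.mem_colon_singleton, Submodule.mem_bot, ← Submodule.Quotient.mk_smul,
      Submodule.Quotient.mk_eq_zero, Algebra.smul_def, mul_comm]
    rfl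
  have hht : P.height = 1 := height_eq_one_of_forall_mem_iff (g := g) fun x => by
    rw [hPg, mem_colon]
  obtain ⟨a, b, hb, hab⟩ := hf ⟨⟨P, hPp⟩, hht⟩
  exact hb (hfP ((mem_colon f b).2 ⟨a, hab.symm⟩))

/-! ### Orders and principal divisors -/

theorem ord_nonneg_iff (p : HeightOnePrime A) (f : (FractionRing A)ˣ) :
    0 ≤ ord p f ↔ IsDefinedAt (f : FractionRing A) p.1 := by
  have hv0 : (IsDiscreteValuationRing.maximalIdeal p.localRing).valuation (FractionRing A)
      (f : FractionRing A) ≠ 0 := (Valuation.ne_zero_iff _).2 f.ne_zero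
  rw [ord, neg_nonneg, ← WithZero.log_one, WithZero.log_le_log hv0 one_ne_zero]
  constructor
  · intro h
    obtain ⟨z, hz⟩ := IsDiscreteValuationRing.exists_lift_of_le_one h
    obtain ⟨⟨a, b⟩, hab⟩ := IsLocalization.surj p.1.asIdeal.primeCompl z
    refine ⟨a, b, b.2, ?_⟩
    rw [← hz, IsScalarTower.algebraMap_apply A p.localRing (FractionRing A),
      IsScalarTower.algebraMap_apply A p.localRing (FractionRing A), ← map_mul, hab]
  · rintro ⟨a, b, hb, hab⟩
    have := congrArg ((IsDiscreteValuationRing.maximalIdeal p.localRing).valuation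
      (FractionRing A)) hab
    rw [map_mul, valuation_eq_one p hb, mul_one] at this
    rw [this, IsScalarTower.algebraMap_apply A p.localRing (FractionRing A)]
    exact IsDedekindDomain.HeightOneSpectrum.valuation_le_one _ _

theorem ord_pos_iff (p : HeightOnePrime A) {h : A} {f : (FractionRing A)ˣ}
    (hf : (f : FractionRing A) = algebraMap A (FractionRing A) h) :
    0 < ord p f ↔ h ∈ p.1.asIdeal := by
  have hv0 : (IsDiscreteValuationRing.maximalIdeal p.localRing).valuation (FractionRing A)
      (f : FractionRing A) ≠ 0 := (Valuation.ne_zero_iff _).2 f.ne_zero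
  rw [ord, neg_pos, ← WithZero.log_one, WithZero.log_lt_log hv0 one_ne_zero, hf,
    IsScalarTower.algebraMap_apply A p.localRing (FractionRing A),
    IsDedekindDomain.HeightOneSpectrum.valuation_lt_one_iff_mem]
  exact IsLocalization.AtPrime.to_map_mem_maximal_iff p.localRing p.1.asIdeal h

theorem ord_nonneg_of_eq_algebraMap (p : HeightOnePrime A) {h : A} {f : (FractionRing A)ˣ}
    (hf : (f : FractionRing A) = algebraMap A (FractionRing A) h) : 0 ≤ ord p f :=
  (ord_nonneg_iff p f).2 ⟨h, 1, p.1.2.one_notMem, by rw [hf, map_one, mul_one]⟩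

theorem principal_apply (f : (FractionRing A)ˣ) (p : HeightOnePrime A) :
    principal A (Additive.ofMul f) p = ord p f := rfl

theorem isOfFinAddOrder_mk_iff (D : Divisor A) :
    IsOfFinAddOrder (QuotientAddGroup.mk D : DivisorClassGroup A) ↔
      ∃ n : ℕ, 0 < n ∧ ∃ f : (FractionRing A)ˣ, ∀ p, ord p f = n * D p := by
  rw [isOfFinAddOrder_iff_nsmul_eq_zero]
  refine exists_congr fun n => and_congr_right fun _ => ?_
  rw [← QuotientAddGroup.mk_nsmul, QuotientAddGroup.eq_zero_iff]
  constructor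
  · rintro ⟨f, hf⟩
    refine ⟨f.toMul, fun p => ?_⟩
    rw [← principal_apply, ofMul_toMul, hf]
    simp
  · rintro ⟨f, hf⟩
    refine ⟨Additive.ofMul f, Finsupp.ext fun p => ?_⟩
    rw [principal_apply, hf]
    simp

/-- The class group is generated by the classes of the primes of height one, so it is torsion as
soon as these classes have finite order. -/
theorem isAlmostFactorial_of_single
    (h : ∀ p : HeightOnePrime A, IsOfFinAddOrder
      (QuotientAddGroup.mk (Finsupp.single p 1) : DivisorClassGroup A)) :
    IsAlmostFactorial A := by
  intro x
  obtain ⟨D, rfl⟩ := QuotientAddGroup.mk_surjective x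
  induction D using Finsupp.induction_linear with
  | zero => exact IsOfFinAddOrder.zero
  | add D E hD hE => exact hD.add hE
  | single p k =>
    have hk : (Finsupp.single p k : Divisor A) = k • Finsupp.single p 1 := by
      rw [Finsupp.smul_single, smul_eq_mul, mul_one]
    rw [hk, QuotientAddGroup.mk_zsmul]
    exact (h p).zsmul

/-! ### Torsion of the class group and denominators -/

/-- If the class group is torsion, a multiple of the divisor of poles of `f` is the divisor of some
`h`, which serves as a denominator of `f` and vanishes only at poles of `f`. -/
theorem IsAlmostFactorial.exists_mem_filter (hA : IsAlmostFactorial A)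
    {U : Opens (PrimeSpectrum A)} {f : FractionRing A} (hf : ∀ q ∈ U, IsDefinedAt f q) :
    ∃ a : A, ∃ g ∈ filter A U,
      f * algebraMap A (FractionRing A) g = algebraMap A (FractionRing A) a := by
  rcases eq_or_ne f 0 with rfl | hf0
  · exact ⟨0, 1, one_mem _, by simp⟩
  lift f to (FractionRing A)ˣ using hf0.isUnit
  let D : Divisor A := Finsupp.ofSupportFinite (fun p => max 0 (-ord p f))
    ((finite_ord_ne_zero f).subset fun p hp h => hp (by simp [h]))
  have hD : ∀ p, D p = max 0 (-ord p f) := fun p => rfl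
  obtain ⟨n, hn, h, hh⟩ := (isOfFinAddOrder_mk_iff D).1 (hA _)
  have hn' : (1 : ℤ) ≤ n := by exact_mod_cast hn
  obtain ⟨g, hg⟩ := mem_range_of_isDefinedAt (f := (h : FractionRing A)) fun p => by
    rw [← ord_nonneg_iff, hh, hD]
    positivity
  obtain ⟨a, ha⟩ := mem_range_of_isDefinedAt (f := ((f * h : (FractionRing A)ˣ) : FractionRing A))
    fun p => by
      rw [← ord_nonneg_iff, ord_mul, hh, hD]
      nlinarith [le_max_left 0 (-ord p f), le_max_right 0 (-ord p f)]
  refine ⟨a, g, fun q hq hgq => ?_, by rw [ha, hg, Units.val_mul]⟩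
  have hg0 : g ≠ 0 := by
    rintro rfl
    exact h.ne_zero (by rw [← hg, map_zero])
  obtain ⟨p, hgp, hpq⟩ := exists_heightOnePrime_le hg0 hgq
  have h1 : 0 ≤ ord p f := (ord_nonneg_iff p f).2 ((hf q hq).of_le hpq)
  have h2 : 0 < ord p h := (ord_pos_iff p hg.symm).2 hgp
  rw [hh, hD, max_eq_left (by linarith), mul_zero] at h2
  exact h2.false

/-- Let `f` be a rational function whose denominators form the prime `p` of height one. It is
defined outside `V(p)`, and a denominator `h` of `f` that vanishes nowhere outside `V(p)` has
divisor `n p` with `n > 0`. -/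
theorem isOfFinAddOrder_single
    (hA : ∀ (U : Opens (PrimeSpectrum A)) (f : FractionRing A),
      (∀ q ∈ U, IsDefinedAt f q) → ∃ a : A, ∃ g ∈ filter A U,
        f * algebraMap A (FractionRing A) g = algebraMap A (FractionRing A) a)
    (p : HeightOnePrime A) :
    IsOfFinAddOrder (QuotientAddGroup.mk (Finsupp.single p 1) : DivisorClassGroup A) := by
  obtain ⟨f, hf⟩ := exists_mem_iff_mul_mem_range p
  let U : Opens (PrimeSpectrum A) :=
    ⟨(PrimeSpectrum.zeroLocus (p.1.asIdeal : Set A))ᶜ,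
      (PrimeSpectrum.isClosed_zeroLocus _).isOpen_compl⟩
  have mem_U : ∀ q : PrimeSpectrum A, q ∈ U ↔ ¬ p.1.asIdeal ≤ q.asIdeal := fun q => Iff.rfl
  obtain ⟨a, h, hU, ha⟩ := hA U f fun q hq => by
    obtain ⟨x, hxp, hxq⟩ := SetLike.not_le_iff_exists.1 ((mem_U q).1 hq)
    obtain ⟨y, hy⟩ := (hf x).1 hxp
    exact ⟨y, x, hxq, hy.symm⟩
  have hhp : h ∈ p.1.asIdeal := (hf h).2 ⟨a, ha.symm⟩
  have hh0 : h ≠ 0 := by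
    rintro rfl
    -- The generic point lies in `U`, because `p ≠ 0`.
    exact hU ⊥ ((mem_U ⊥).2 fun hle => p.asIdeal_ne_bot (le_bot_iff.1 hle)) (Ideal.zero_mem _)
  have hunit : IsUnit (algebraMap A (FractionRing A) h) := by
    rwa [isUnit_iff_ne_zero, Ne, IsFractionRing.to_map_eq_zero_iff]
  obtain ⟨u, hu⟩ := hunit
  have hpos : 0 < ord p u := (ord_pos_iff p hu).2 hhp
  refine (isOfFinAddOrder_mk_iff _).2 ⟨(ord p u).toNat, by omega, u, fun q => ?_⟩
  rw [Int.toNat_of_nonneg hpos.le]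
  rcases eq_or_ne p q with rfl | hpq
  · rw [Finsupp.single_eq_same, mul_one]
  · rw [Finsupp.single_eq_of_ne' hpq, mul_zero]
    have hqU : q.1 ∈ U := by
      rw [mem_U]
      intro hle
      have := p.finiteHeight
      exact hpq (Subtype.ext (PrimeSpectrum.ext
        (Ideal.eq_of_le_of_height_le _ hle (by rw [p.2, q.2]))))
    exact le_antisymm (not_lt.1 fun hlt => hU q.1 hqU ((ord_pos_iff q hu).1 hlt))
      (ord_nonneg_of_eq_algebraMap q hu)

end WeilDivisor

theorem mainTheorem6 (A : Type u) [CommRing A] [IsDomain A] [IsNoetherianRing A]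
    [IsIntegrallyClosed A] :
    IsIso (FilterPresheaf.toStructureSheaf A) ↔ WeilDivisor.IsAlmostFactorial A := by
  rw [FilterPresheaf.isIso_toStructureSheaf_iff]
  exact ⟨fun h => WeilDivisor.isAlmostFactorial_of_single (WeilDivisor.isOfFinAddOrder_single h),
    fun h _ _ hf => h.exists_mem_filter hf⟩
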